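/- Let $1\le p<\infty$, let $\mathbb{K}$ be $\mathbb{R}$ or $\mathbb{C}$, let $\mathbb{N}=\{1,2,\dots\}$, and let $\ell^p(\mathbb{N})$ be the space of $p$-summable $\mathbb{K}$-valued sequences with canonical basis $(e_j)_{j\ge1}$. For a strictly increasing map $f:\mathbb{N}\to\mathbb{N}$ with $f(1)>1$ and scalars $w=(w_j)_{j\ge1}$ such that $(w_{f(j)})_{j\ge1}$ is bounded, the unilateral pseudo-shift $T_{f,w}$ is the bounded operator on $\ell^p(\mathbb{N})$ given by $T_{f,w}\big(\sum_{j\ge1}x_je_j\big)=\sum_{j\ge1}w_{f(j)}x_{f(j)}e_j$. For a bounded sequence $w$, the weighted shift $B_w$ (with $B_we_1=0$ and $B_we_n=w_ne_{n-1}$ for $n\ge2$) is the pseudo-shift with $f(n)=n+1$. Let $\mathcal{A}_{uBd}$ be the family of all sets $A$ of natural numbers whose upper Banach density \[\overline{\mathrm{Bd}}(A)=\limsup_{N\to\infty}\max_{k\ge1}\frac{\mathrm{card}(A\cap[k+1,k+N])}{N}\] is positive. A bounded operator $T$ on a Banach space $X$ is reiteratively hypercyclic if there is $x\in X$ such that $\{n:T^nx\in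 U\}\in\mathcal{A}_{uBd}$ for every non-empty open $U\subseteq X$. Bounded operators $T_1,T_2$ on $X$ are disjoint hypercyclic if there is $x\in X$ such that $\{(T_1^nx,T_2^nx):n\ge 0\}$ is dense in $X\times X$; they are disjoint reiteratively hypercyclic if there is $x\in X$ such that $\{n:(T_1^nx,T_2^nx)\in U\}\in\mathcal{A}_{uBd}$ for every non-empty open $U\subseteq X\times X$. For increasing maps $f_1,f_2:\mathbb{N}\to\mathbb{N}$, the family $\mathcal{A}_{uBd}$ is $(f_1,f_2)$-almost partition regular if for every $l\ge1$ and every $B\in\mathcal{A}_{uBd}$ there is $A\subseteq B$, $A\in\mathcal{A}_{uBd}$, such that $f_s^m(\{1,\dots,l\})\cap f_t^n(\{1,\dots,l\})=\emptyset$ for all $m\ne n$ in $A$ and all $s,t\in\{1,2\}$. \textbf{Theorem.} Let $T_1=T_{f_1,w_1}$ and $T_2=T_{f_2,w_2}$ be unilateral pseudo-shifts on $\ell^p(\mathbb{N})$, $1\le p<\infty$, such that $f_1=f_2$ and $\mathcal{A}_{uBd}$ is $(f_1,f_2)$-almost partition regular. Then $T_1,T_2$ are disjoint reiteratively hypercyclic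 if and only if $T_1$ and $T_2$ are both reiteratively hypercyclic and $T_1,T_2$ are disjoint hypercyclic. In particular, for any bounded weight sequences $w_1,w_2$, the weighted shifts $B_{w_1},B_{w_2}$ on $\ell^p(\mathbb{N})$ are disjoint reiteratively hypercyclic if and only if both are reiteratively hypercyclic and the pair is disjoint hypercyclic. -/

import Mathlib

open Filter
open scoped ENNReal

/-! ### Densities and families of sets of natural numbers -/

/-- Upper Banach density of `A ⊆ ℕ`:
`limsup_{N → ∞} max_{k ≥ 1} card (A ∩ [k + 1, k + N]) / N`. -/
noncomputable def upperBanachDensity (A : Set ℕ) : ℝ :=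
  limsup (fun N : ℕ => ⨆ k : ℕ+, ((A ∩ Set.Icc ((k : ℕ) + 1) ((k : ℕ) + N)).ncard : ℝ) / N) atTop

/-- The family of sets of positive upper Banach density. -/
def familyUBd : Set (Set ℕ) := {A | 0 < upperBanachDensity A}

/-- `𝒜` is `(f_s)`-almost partition regular. Here `[l] = {1, …, l}` is `Set.Icc 1 l`. -/
def AlmostPartitionRegular {N : ℕ} (𝒜 : Set (Set ℕ)) (f : Fin N → ℕ+ → ℕ+) : Prop :=
  ∀ l : ℕ+, ∀ B ∈ 𝒜, ∃ A ⊆ B, A ∈ 𝒜 ∧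
    ∀ m ∈ A, ∀ n ∈ A, m ≠ n → ∀ s t : Fin N,
      ((f s)^[m] '' Set.Icc 1 l) ∩ ((f t)^[n] '' Set.Icc 1 l) = ∅

/-! ### Hypercyclicity and disjointness -/

section Dynamics

variable {𝕜 X : Type*} [NontriviallyNormedField 𝕜] [NormedAddCommGroup X] [NormedSpace 𝕜 X]

/-- `x` is a hypercyclic vector for `T`: its orbit is dense. -/
def IsHypercyclicVector (T : X →L[𝕜] X) (x : X) : Prop :=
  Dense (Set.range fun n : ℕ => (T ^ n) x)

/-- `x` is an `𝒜`-hypercyclic vector for `T`. -/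
def IsFamilyHypercyclicVector (𝒜 : Set (Set ℕ)) (T : X →L[𝕜] X) (x : X) : Prop :=
  ∀ U : Set X, IsOpen U → U.Nonempty → {n : ℕ | (T ^ n) x ∈ U} ∈ 𝒜

/-- `T` is reiteratively hypercyclic. -/
def ReiterativelyHypercyclic (T : X →L[𝕜] X) : Prop :=
  ∃ x : X, IsFamilyHypercyclicVector familyUBd T x

/-- The direct sum `T_1 ⊕ ⋯ ⊕ T_N` acting coordinatewise on `X ^ N`. -/
def directSumOp {N : ℕ} (T : Fin N → X →L[𝕜] X) : (Fin N → X) →L[𝕜] (Fin N → X) :=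
  ContinuousLinearMap.pi fun s => (T s).comp (ContinuousLinearMap.proj s)

/-- `T_1, …, T_N` are disjoint hypercyclic. -/
def DisjointHypercyclic {N : ℕ} (T : Fin N → X →L[𝕜] X) : Prop :=
  ∃ x : X, IsHypercyclicVector (directSumOp T) (fun _ => x)

/-- `T_1, …, T_N` are disjoint reiteratively hypercyclic. -/
def DisjointReiterativelyHypercyclic {N : ℕ} (T : Fin N → X →L[𝕜] X) : Prop :=
  ∃ x : X, IsFamilyHypercyclicVector familyUBd (directSumOp T) (fun _ => x)

end Dynamics

/-! ### Pseudo-shifts and weighted shifts on `ℓ^p` -/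

section PseudoShift

variable {𝕜 : Type*} [RCLike 𝕜] (p : ℝ≥0∞)

theorem pseudoShift_sum_le {r C : ℝ} (hr : 0 < r) (hC : 0 ≤ C)
    {f : ℕ+ → ℕ+} (hf : StrictMono f) {w : ℕ+ → 𝕜} (hw : ∀ j, ‖w (f j)‖ ≤ C)
    (x : ℕ+ → 𝕜) (B : ℝ) (hB : ∀ s : Finset ℕ+, ∑ i ∈ s, ‖x i‖ ^ r ≤ B) (s : Finset ℕ+) :
    ∑ j ∈ s, ‖w (f j) * x (f j)‖ ^ r ≤ C ^ r * B := by
  calc ∑ j ∈ s, ‖w (f j) * x (f j)‖ ^ r ≤ ∑ j ∈ s, C ^ r * ‖x (f j)‖ ^ r := by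
        refine Finset.sum_le_sum fun j _ => ?_
        rw [norm_mul, Real.mul_rpow (norm_nonneg _) (norm_nonneg _)]
        gcongr
        exact hw j
    _ = C ^ r * ∑ i ∈ s.map ⟨f, hf.injective⟩, ‖x i‖ ^ r := by
        simp [Finset.mul_sum]
    _ ≤ C ^ r * B := by
        gcongr
        exact hB _

theorem pseudoShift_memℓp [Fact (1 ≤ p)] {f : ℕ+ → ℕ+} (hf : StrictMono f) {w : ℕ+ → 𝕜}
    (hw : ∃ C : ℝ, ∀ j, ‖w (f j)‖ ≤ C) (x : lp (fun _ : ℕ+ => 𝕜) p) :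
    Memℓp (fun j => w (f j) * x (f j)) p := by
  obtain ⟨C, hC⟩ := hw
  have hC0 : 0 ≤ C := (norm_nonneg _).trans (hC 1)
  rcases eq_or_ne p ∞ with rfl | hp
  · refine memℓp_infty ⟨C * ‖x‖, ?_⟩
    rintro _ ⟨j, rfl⟩
    simp only [norm_mul]
    exact mul_le_mul (hC j) (lp.norm_apply_le_norm (by simp) x _) (norm_nonneg _) hC0
  · have hr : 0 < p.toReal :=
      ENNReal.toReal_pos (zero_lt_one.trans_le Fact.out).ne' hp
    exact memℓp_gen' (C := C ^ p.toReal * ‖x‖ ^ p.toReal) (fun s =>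
      pseudoShift_sum_le hr hC0 hf hC x _ (fun s => lp.sum_rpow_le_norm_rpow hr x s) s)

/-- The pseudo-shift `T_{f,w}` on `ℓ^p`, `T_{f,w} (∑ x_j e_j) = ∑ w_{f(j)} x_{f(j)} e_j`, for a
strictly increasing `f`; the indices are the positive integers. The weights are bounded along the
range of `f`, which is what it takes for the formula to map `ℓ^p` into itself. -/
noncomputable def pseudoShift [Fact (1 ≤ p)] (f : ℕ+ → ℕ+) (hf : StrictMono f) (w : ℕ+ → 𝕜)
    (hw : ∃ C : ℝ, ∀ j, ‖w (f j)‖ ≤ C) :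
    lp (fun _ : ℕ+ => 𝕜) p →L[𝕜] lp (fun _ : ℕ+ => 𝕜) p :=
  LinearMap.mkContinuousOfExistsBound
    { toFun := fun x => ⟨fun j => w (f j) * x (f j), pseudoShift_memℓp p hf hw x⟩
      map_add' := fun x y => by
        ext j
        exact mul_add (w (f j)) (x (f j)) (y (f j))
      map_smul' := fun c x => by
        ext j
        exact mul_left_comm (w (f j)) c (x (f j)) }
    (by
      obtain ⟨C, hC⟩ := hw
      have hC0 : 0 ≤ C := (norm_nonneg _).trans (hC 1)
      refine ⟨C, fun x => ?_⟩
      rcases eq_or_ne p ∞ with rfl | hp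
      · refine lp.norm_le_of_forall_le (by positivity) fun j => ?_
        simp only [LinearMap.coe_mk, AddHom.coe_mk, norm_mul]
        exact mul_le_mul (hC j) (lp.norm_apply_le_norm (by simp) x _) (norm_nonneg _) hC0
      · have hr : 0 < p.toReal :=
          ENNReal.toReal_pos (zero_lt_one.trans_le Fact.out).ne' hp
        refine lp.norm_le_of_forall_sum_le hr (by positivity) fun s => ?_
        rw [Real.mul_rpow hC0 (norm_nonneg _)]
        exact pseudoShift_sum_le hr hC0 hf hC x _ (fun s => lp.sum_rpow_le_norm_rpow hr x s) s)

theorem pseudoShift_apply [Fact (1 ≤ p)] (f : ℕ+ → ℕ+) (hf : StrictMono f) (w : ℕ+ → 𝕜)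
    (hw : ∃ C : ℝ, ∀ j, ‖w (f j)‖ ≤ C) (x : lp (fun _ : ℕ+ => 𝕜) p) (j : ℕ+) :
    pseudoShift p f hf w hw x j = w (f j) * x (f j) := rfl

theorem strictMono_add_one_pnat : StrictMono (fun n : ℕ+ => n + 1) :=
  fun _ _ h => add_lt_add_left h 1

/-- The weighted backward shift `B_w` on `ℓ^p` for a bounded weight sequence `w`: the pseudo-shift
with inducing map `n ↦ n + 1`. -/
noncomputable def weightedShift [Fact (1 ≤ p)] (w : ℕ+ → 𝕜) (hw : ∃ C : ℝ, ∀ n, ‖w n‖ ≤ C) :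
    lp (fun _ : ℕ+ => 𝕜) p →L[𝕜] lp (fun _ : ℕ+ => 𝕜) p :=
  pseudoShift p (fun n => n + 1) strictMono_add_one_pnat w
    (hw.imp fun _ h j => h (j + 1))

/-- `B_w e_1 = 0`. -/
theorem weightedShift_single_one [Fact (1 ≤ p)] (w : ℕ+ → 𝕜) (hw : ∃ C : ℝ, ∀ n, ‖w n‖ ≤ C) :
    weightedShift p w hw (lp.single p 1 1) = 0 := by
  ext j
  have h : j + 1 ≠ 1 := (PNat.lt_add_left 1 j).ne'
  simp [weightedShift, pseudoShift_apply, lp.coeFn_single, h]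

/-- `B_w e_n = w_n e_{n-1}` for `n ≥ 2`. -/
theorem weightedShift_single_add_one [Fact (1 ≤ p)] (w : ℕ+ → 𝕜)
    (hw : ∃ C : ℝ, ∀ n, ‖w n‖ ≤ C) (n : ℕ+) :
    weightedShift p w hw (lp.single p (n + 1) 1) = w (n + 1) • lp.single p n 1 := by
  ext j
  by_cases h : j = n
  · subst h
    simp [weightedShift, pseudoShift_apply, lp.coeFn_single]
  · simp [weightedShift, pseudoShift_apply, lp.coeFn_single, h]

end PseudoShift

/-! ### Windows in sets of positive upper Banach density -/

/-! The equivalence holds for any two bounded operators on a normed space, because positive upper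
Banach density only asks for arbitrarily long windows with a fixed proportion of hits, wherever
those windows lie. Each reiteratively hypercyclic vector visits its target ball on such a set.
Pigeonholing over translations aligns two windows so that they share a proportion of times
independent of their length (`exists_common_windows`). Moving each vector along its own orbit then
gives a pair whose joint orbit hits the target at all shared times. This is an open condition, so
the disjoint hypercyclic orbit enters it and repeats the pattern
(`IsHypercyclicVector.isFamilyHypercyclicVector_directSumOp`). -/

theorem window_ratio_le_one (A : Set ℕ) (k N : ℕ) :
    ((A ∩ Set.Icc (k + 1) (k + N)).ncard : ℝ) / N ≤ 1 := by
  refine div_le_one_of_le₀ ?_ (Nat.cast_nonneg N)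
  have h := Set.ncard_le_ncard (s := A ∩ Set.Icc (k + 1) (k + N)) Set.inter_subset_right
    (Set.finite_Icc _ _)
  rw [← Finset.coe_Icc, Set.ncard_coe_finset, Nat.card_Icc] at h
  exact_mod_cast h.trans (by omega)

theorem bddAbove_window_ratio (A : Set ℕ) (N : ℕ) :
    BddAbove (Set.range fun k : ℕ+ =>
      ((A ∩ Set.Icc ((k : ℕ) + 1) ((k : ℕ) + N)).ncard : ℝ) / N) :=
  ⟨1, by rintro _ ⟨k, rfl⟩; exact window_ratio_le_one A k N⟩

theorem iSup_window_ratio_nonneg (A : Set ℕ) (N : ℕ) :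
    0 ≤ ⨆ k : ℕ+, ((A ∩ Set.Icc ((k : ℕ) + 1) ((k : ℕ) + N)).ncard : ℝ) / N :=
  Real.iSup_nonneg fun _ => by positivity

theorem iSup_window_ratio_le_one (A : Set ℕ) (N : ℕ) :
    ⨆ k : ℕ+, ((A ∩ Set.Icc ((k : ℕ) + 1) ((k : ℕ) + N)).ncard : ℝ) / N ≤ 1 :=
  ciSup_le fun k => window_ratio_le_one A k N

/-- If arbitrarily long windows contain a fixed proportion of elements of `A`, then `A` has
positive upper Banach density. -/
theorem mem_familyUBd_of_windows {A : Set ℕ} {δ : ℝ} (hδ : 0 < δ)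
    (h : ∀ N : ℕ, ∃ s : ℕ, ∃ F : Finset ℕ, (↑F ⊆ A ∩ Set.Ico s (s + N)) ∧ δ * N ≤ F.card) :
    A ∈ familyUBd := by
  have key : δ / 2 ≤ upperBanachDensity A := by
    refine le_limsup_of_frequently_le (Eventually.frequently ?_)
      (isBoundedUnder_of ⟨1, iSup_window_ratio_le_one A⟩)
    -- `N ≥ 4 / δ` makes `δ * N / 2 ≥ 2`, which absorbs the two points lost below.
    filter_upwards [eventually_ge_atTop (⌈4 / δ⌉₊ + 1)] with N hN
    have hN4 : 4 / δ ≤ N := (Nat.le_ceil _).trans (by exact_mod_cast (by omega))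
    have hN0 : (0 : ℝ) < N := by exact_mod_cast (by omega : 0 < N)
    rw [div_le_iff₀ hδ] at hN4
    obtain ⟨s, F, hF, hcard⟩ := h N
    refine le_trans ?_ (le_ciSup (bddAbove_window_ratio A N) s.succPNat)
    rw [le_div_iff₀ hN0]
    -- The density only sees windows with `k ≥ 1`. Taking `k = s + 1` gives `[s + 2, s + 1 + N]`,
    -- which misses just `s` and `s + 1`.
    have hsub : (↑(F \ {s, s + 1}) : Set ℕ) ⊆
        A ∩ Set.Icc ((s.succPNat : ℕ) + 1) ((s.succPNat : ℕ) + N) := by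
      intro n hn
      simp only [Finset.coe_sdiff, Set.mem_sdiff, Finset.mem_coe, Finset.mem_insert,
        Finset.mem_singleton, not_or] at hn
      obtain ⟨hA, h1, h2⟩ := hF hn.1
      refine ⟨hA, ?_, ?_⟩ <;> simp only [Nat.succPNat_coe] <;> omega
    have h1 := Set.ncard_le_ncard hsub ((Set.finite_Icc _ _).subset Set.inter_subset_right)
    rw [Set.ncard_coe_finset] at h1
    have h2 := Finset.le_card_sdiff {s, s + 1} F
    have h3 : ({s, s + 1} : Finset ℕ).card ≤ 2 := Finset.card_le_two
    have h4 := h1.trans' (h2.trans' (Nat.sub_le_sub_left h3 _))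
    have h5 := Nat.cast_le (α := ℝ).mpr (tsub_le_iff_right.mp h4)
    rw [Nat.cast_add, Nat.cast_ofNat] at h5
    linarith
  exact (half_pos hδ).trans_le key

/-- A set of positive upper Banach density has, for a fixed proportion, windows of every length
containing at least this proportion of elements. -/
theorem exists_windows_of_mem_familyUBd {A : Set ℕ} (hA : A ∈ familyUBd) :
    ∃ δ : ℝ, 0 < δ ∧ ∀ N : ℕ, ∃ s : ℕ, ∃ F ⊆ Finset.range N,
      (∀ t ∈ F, s + t ∈ A) ∧ δ * N ≤ F.card := by
  classical
  have hA' : 0 < upperBanachDensity A := hA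
  set d := upperBanachDensity A with hd
  refine ⟨d / 4, by positivity, fun N => ?_⟩
  rcases Nat.eq_zero_or_pos N with rfl | hN
  · exact ⟨0, ∅, by simp, by simp, by simp⟩
  have hfreq := frequently_lt_of_lt_limsup (f := atTop)
    (u := fun N : ℕ => ⨆ k : ℕ+, ((A ∩ Set.Icc ((k : ℕ) + 1) ((k : ℕ) + N)).ncard : ℝ) / N)
    (isCoboundedUnder_le_of_le atTop (x := 0) (iSup_window_ratio_nonneg A))
    (b := d / 2) (by change d / 2 < d; linarith)
  obtain ⟨M, hM, hNM⟩ := (hfreq.and_eventually (eventually_ge_atTop N)).exists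
  obtain ⟨k, hk⟩ := exists_lt_of_lt_ciSup hM
  have hN0 : (0 : ℝ) < N := by exact_mod_cast hN
  have hM0 : (0 : ℝ) < M := by exact_mod_cast hN.trans_le hNM
  rw [lt_div_iff₀ hM0] at hk
  by_contra! hcon
  -- A window of length `M ≥ N` with more than `d / 2 * M` hits is cut into blocks of length `N`. If
  -- every block were sparse, the `M / N + 1` blocks would hold at most `d / 4 * (2 * M)` hits.
  let G (i : ℕ) : Finset ℕ := {t ∈ Finset.range N | (k + 1 + N * i) + t ∈ A}
  have hG (i : ℕ) : ((G i).card : ℝ) < d / 4 * N :=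
    hcon (k + 1 + N * i) (G i) (Finset.filter_subset _ _)
      (fun t ht => (Finset.mem_filter.mp ht).2)
  let cover : Finset ℕ :=
    (Finset.range (M / N + 1)).biUnion fun i => (G i).image fun t => k + 1 + N * i + t
  have hsub : A ∩ Set.Icc ((k : ℕ) + 1) ((k : ℕ) + M) ⊆ ↑cover := by
    rintro n ⟨hnA, h1, h2⟩
    have hdm := Nat.div_add_mod (n - (k + 1)) N
    have hn : k + 1 + N * ((n - (k + 1)) / N) + (n - (k + 1)) % N = n := by omega
    simp only [cover, Finset.coe_biUnion, Set.mem_iUnion, Finset.mem_coe, Finset.mem_range,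
      Finset.mem_image, G, Finset.mem_filter]
    refine ⟨(n - (k + 1)) / N, ?_, (n - (k + 1)) % N, ⟨Nat.mod_lt _ hN, ?_⟩, hn⟩
    · exact Nat.lt_succ_of_le (Nat.div_le_div_right (by omega))
    · rwa [hn]
  have hle := Set.ncard_le_ncard hsub (Finset.finite_toSet cover)
  rw [Set.ncard_coe_finset] at hle
  have hcover : (cover.card : ℝ) ≤ (M / N + 1 : ℕ) * (d / 4 * N) := by
    calc (cover.card : ℝ) ≤ ∑ i ∈ Finset.range (M / N + 1), ((G i).card : ℝ) := by
          exact_mod_cast Finset.card_biUnion_le.trans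
            (Finset.sum_le_sum fun i _ => Finset.card_image_le)
      _ ≤ ∑ _i ∈ Finset.range (M / N + 1), d / 4 * N :=
          Finset.sum_le_sum fun i _ => (hG i).le
      _ = _ := by rw [Finset.sum_const, Finset.card_range, nsmul_eq_mul]
  have hdiv : ((M / N + 1 : ℕ) : ℝ) * N ≤ 2 * M := by
    have h1 := Nat.div_mul_le_self M N
    exact_mod_cast (by rw [add_mul, one_mul]; omega : (M / N + 1) * N ≤ 2 * M)
  have hle' : ((A ∩ Set.Icc ((k : ℕ) + 1) ((k : ℕ) + M)).ncard : ℝ) ≤ cover.card := by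
    exact_mod_cast hle
  nlinarith

theorem nonempty_of_mem_familyUBd {A : Set ℕ} (hA : A ∈ familyUBd) : A.Nonempty := by
  obtain ⟨δ, hδ, h⟩ := exists_windows_of_mem_familyUBd hA
  obtain ⟨s, F, -, hF, hcard⟩ := h 1
  have : F.Nonempty := by
    rw [← Finset.card_pos]
    have : (0 : ℝ) < F.card := lt_of_lt_of_le (by simpa using hδ) hcard
    exact_mod_cast this
  obtain ⟨t, ht⟩ := this
  exact ⟨s + t, hF t ht⟩

/-- Two finite subsets of `[0, N)` have a large intersection after translating one of them. -/
theorem exists_shift_card_mul_card_le (N : ℕ) (F₁ F₂ : Finset ℕ) (h₁ : F₁ ⊆ Finset.range N)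
    (h₂ : F₂ ⊆ Finset.range N) :
    ∃ u₁ u₂ : ℕ, ∃ F ⊆ Finset.range N, (∀ t ∈ F, u₁ + t ∈ F₁ ∧ u₂ + t ∈ F₂) ∧
      F₁.card * F₂.card ≤ 2 * N * F.card := by
  classical
  rcases Nat.eq_zero_or_pos N with rfl | hN
  · have : F₁ = ∅ := by simpa using h₁
    exact ⟨0, 0, ∅, by simp, by simp, by simp [this]⟩
  by_contra! hcon
  -- Pigeonhole on the difference of the two coordinates, raised by `N` to stay in `ℕ`: it takes
  -- fewer than `2 * N` values, and a fibre is an intersection of translates.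
  have hmaps : ∀ q ∈ F₁ ×ˢ F₂, q.1 + N - q.2 ∈ Finset.range (2 * N) := by
    intro q hq
    have hq' := Finset.mem_product.mp hq
    have := Finset.mem_range.mp (h₁ hq'.1)
    exact Finset.mem_range.mpr (by omega)
  have hsum := Finset.card_eq_sum_card_fiberwise hmaps
  have hfib : ∀ c ∈ Finset.range (2 * N),
      2 * N * ((F₁ ×ˢ F₂).filter fun q => q.1 + N - q.2 = c).card < F₁.card * F₂.card := by
    intro c _
    -- The sign of the difference decides which set is translated, so that both shifts are natural
    -- numbers.
    rcases le_total N c with hc | hc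
    · have hle : ((F₁ ×ˢ F₂).filter fun q => q.1 + N - q.2 = c).card ≤
          ((Finset.range N).filter fun t => (c - N) + t ∈ F₁ ∧ 0 + t ∈ F₂).card := by
        refine Finset.card_le_card_of_injOn Prod.snd ?_ ?_
        · rintro ⟨a, b⟩ hq
          simp only [Finset.coe_filter, Finset.mem_product, Set.mem_ofPred_eq] at hq
          have hb := Finset.mem_range.mp (h₂ hq.1.2)
          have hab : c - N + b = a := by omega
          simp only [Finset.coe_filter, Finset.mem_range, Set.mem_ofPred_eq]
          exact ⟨hb, by rw [hab]; exact hq.1.1, by simpa using hq.1.2⟩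
        · rintro ⟨a, b⟩ hq ⟨a', b'⟩ hq' (rfl : b = b')
          simp only [Finset.coe_filter, Finset.mem_product, Set.mem_ofPred_eq] at hq hq'
          have hb := Finset.mem_range.mp (h₂ hq.1.2)
          simp only [Prod.mk.injEq, and_true]
          omega
      exact (Nat.mul_le_mul_left _ hle).trans_lt
        (hcon (c - N) 0 _ (Finset.filter_subset _ _) fun t ht => (Finset.mem_filter.mp ht).2)
    · have hle : ((F₁ ×ˢ F₂).filter fun q => q.1 + N - q.2 = c).card ≤
          ((Finset.range N).filter fun t => 0 + t ∈ F₁ ∧ (N - c) + t ∈ F₂).card := by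
        refine Finset.card_le_card_of_injOn Prod.fst ?_ ?_
        · rintro ⟨a, b⟩ hq
          simp only [Finset.coe_filter, Finset.mem_product, Set.mem_ofPred_eq] at hq
          have ha := Finset.mem_range.mp (h₁ hq.1.1)
          have hb := Finset.mem_range.mp (h₂ hq.1.2)
          have hab : N - c + a = b := by omega
          simp only [Finset.coe_filter, Finset.mem_range, Set.mem_ofPred_eq]
          exact ⟨ha, by simpa using hq.1.1, by rw [hab]; exact hq.1.2⟩
        · rintro ⟨a, b⟩ hq ⟨a', b'⟩ hq' (rfl : a = a')
          simp only [Finset.coe_filter, Finset.mem_product, Set.mem_ofPred_eq] at hq hq'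
          have hb := Finset.mem_range.mp (h₂ hq.1.2)
          have hb' := Finset.mem_range.mp (h₂ hq'.1.2)
          simp only [Prod.mk.injEq, true_and]
          omega
      exact (Nat.mul_le_mul_left _ hle).trans_lt
        (hcon 0 (N - c) _ (Finset.filter_subset _ _) fun t ht => (Finset.mem_filter.mp ht).2)
  have hlt := Finset.sum_lt_sum_of_nonempty
    (Finset.nonempty_range_iff.mpr (by omega : 2 * N ≠ 0)) hfib
  rw [← Finset.mul_sum, ← hsum, Finset.sum_const, Finset.card_range, smul_eq_mul,
    Finset.card_product] at hlt
  exact lt_irrefl _ hlt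

/-- Two sets of positive upper Banach density have long windows that, once aligned, share a fixed
proportion of elements. -/
theorem exists_common_windows {A₁ A₂ : Set ℕ} (h₁ : A₁ ∈ familyUBd) (h₂ : A₂ ∈ familyUBd) :
    ∃ δ : ℝ, 0 < δ ∧ ∀ N : ℕ, ∃ u₁ u₂ : ℕ, ∃ F ⊆ Finset.range N,
      (∀ t ∈ F, u₁ + t ∈ A₁ ∧ u₂ + t ∈ A₂) ∧ δ * N ≤ F.card := by
  obtain ⟨δ₁, hδ₁, H₁⟩ := exists_windows_of_mem_familyUBd h₁
  obtain ⟨δ₂, hδ₂, H₂⟩ := exists_windows_of_mem_familyUBd h₂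
  -- From `F.card ≥ F₁.card * F₂.card / (2 * N) ≥ (δ₁ * N) * (δ₂ * N) / (2 * N)`.
  refine ⟨δ₁ * δ₂ / 2, by positivity, fun N => ?_⟩
  obtain ⟨s₁, F₁, hF₁, hA₁, hc₁⟩ := H₁ N
  obtain ⟨s₂, F₂, hF₂, hA₂, hc₂⟩ := H₂ N
  obtain ⟨u₁, u₂, F, hF, hmem, hcard⟩ := exists_shift_card_mul_card_le N F₁ F₂ hF₁ hF₂
  refine ⟨s₁ + u₁, s₂ + u₂, F, hF, fun t ht => ?_, ?_⟩
  · rw [add_assoc, add_assoc]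
    exact ⟨hA₁ _ (hmem t ht).1, hA₂ _ (hmem t ht).2⟩
  rcases Nat.eq_zero_or_pos N with rfl | hN
  · simp
  have hN0 : (0 : ℝ) < N := by exact_mod_cast hN
  have hcard' : (F₁.card : ℝ) * F₂.card ≤ 2 * N * F.card := by exact_mod_cast hcard
  have hmul : (δ₁ * N) * (δ₂ * N) ≤ F₁.card * F₂.card :=
    mul_le_mul hc₁ hc₂ (by positivity) (by positivity)
  have : (2 * N) * (δ₁ * δ₂ / 2 * N) ≤ (2 * N) * (F.card : ℝ) := by
    calc (2 * N) * (δ₁ * δ₂ / 2 * N) = (δ₁ * N) * (δ₂ * N) := by ring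
      _ ≤ _ := hmul.trans hcard'
  exact le_of_mul_le_mul_left this (by positivity)

/-! ### Disjoint reiterative hypercyclicity of pairs of operators -/

section Dynamics

variable {𝕜 X : Type*} [NontriviallyNormedField 𝕜] [NormedAddCommGroup X] [NormedSpace 𝕜 X]

theorem directSumOp_pow_apply {N : ℕ} (T : Fin N → X →L[𝕜] X) (n : ℕ) (x : Fin N → X)
    (s : Fin N) : (directSumOp T ^ n) x s = (T s ^ n) (x s) := by
  induction n generalizing x with
  | zero => simp
  | succ n ih =>
    rw [pow_succ, pow_succ, mul_apply_eq_comp, mul_apply_eq_comp, ih]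
    rfl

theorem DisjointReiterativelyHypercyclic.reiterativelyHypercyclic {N : ℕ}
    {T : Fin N → X →L[𝕜] X} (h : DisjointReiterativelyHypercyclic T) (s : Fin N) :
    ReiterativelyHypercyclic (T s) := by
  obtain ⟨x, hx⟩ := h
  refine ⟨x, fun U hU hne => ?_⟩
  have := hx {y | y s ∈ U} (hU.preimage (continuous_apply s)) (hne.imp' (fun y _ => y) (by simp))
  simpa only [Set.mem_ofPred_eq, directSumOp_pow_apply] using this

theorem DisjointReiterativelyHypercyclic.disjointHypercyclic {N : ℕ}
    {T : Fin N → X →L[𝕜] X} (h : DisjointReiterativelyHypercyclic T) :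
    DisjointHypercyclic T := by
  obtain ⟨x, hx⟩ := h
  refine ⟨x, dense_iff_inter_open.mpr fun U hU hne => ?_⟩
  obtain ⟨n, hn⟩ := nonempty_of_mem_familyUBd (hx U hU hne)
  exact ⟨_, hn, n, rfl⟩

/-- A disjoint hypercyclic vector for two reiteratively hypercyclic operators is disjoint
reiteratively hypercyclic. -/
theorem IsHypercyclicVector.isFamilyHypercyclicVector_directSumOp {T : Fin 2 → X →L[𝕜] X}
    (hT : ∀ s, ReiterativelyHypercyclic (T s)) {x : Fin 2 → X}
    (hx : IsHypercyclicVector (directSumOp T) x) :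
    IsFamilyHypercyclicVector familyUBd (directSumOp T) x := by
  intro U hU hne
  choose a ha using hT
  obtain ⟨y, hy⟩ := hne
  obtain ⟨ε, hε, hball⟩ := Metric.isOpen_iff.mp hU y hy
  have hvisit (s : Fin 2) : {n : ℕ | (T s ^ n) (a s) ∈ Metric.ball (y s) ε} ∈ familyUBd :=
    ha s _ Metric.isOpen_ball ⟨y s, Metric.mem_ball_self hε⟩
  obtain ⟨δ, hδ, H⟩ := exists_common_windows (hvisit 0) (hvisit 1)
  refine mem_familyUBd_of_windows hδ fun N => ?_
  obtain ⟨u₀, u₁, F, hF, hmem, hcard⟩ := H N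
  -- The two shifts may differ, since `b` need not lie on the diagonal or on the orbit of `x`.
  let b : Fin 2 → X := ![(T 0 ^ u₀) (a 0), (T 1 ^ u₁) (a 1)]
  have hb : ∀ t ∈ F, (directSumOp T ^ t) b ∈ U := by
    intro t ht
    obtain ⟨h0, h1⟩ := hmem t ht
    refine hball ?_
    rw [Metric.mem_ball, dist_pi_lt_iff hε]
    intro s
    rw [directSumOp_pow_apply]
    fin_cases s
    · simpa [b, add_comm u₀ t, Function.iterate_add_apply] using h0
    · simpa [b, add_comm u₁ t, Function.iterate_add_apply] using h1
  -- Finiteness of `F` keeps this set open. When the orbit of `x` enters it at time `n`, all of `n +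
  -- F` are visits to `U`.
  have hV : IsOpen (⋂ t ∈ F, (directSumOp T ^ t) ⁻¹' U) :=
    isOpen_biInter_finset fun t _ => hU.preimage (directSumOp T ^ t).continuous
  obtain ⟨_, hn, n, rfl⟩ := hx.inter_open_nonempty _ hV ⟨b, Set.mem_iInter₂.mpr hb⟩
  refine ⟨n, F.map (addLeftEmbedding n), ?_, by simpa using hcard⟩
  intro m hm
  obtain ⟨t, ht, rfl⟩ := Finset.mem_map.mp (Finset.mem_coe.mp hm)
  have htN := Finset.mem_range.mp (hF ht)
  refine ⟨?_, by simp, by simpa using htN⟩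
  have := Set.mem_iInter₂.mp hn t ht
  simpa [add_comm n t, Function.iterate_add_apply] using this

theorem disjointReiterativelyHypercyclic_iff (T : Fin 2 → X →L[𝕜] X) :
    DisjointReiterativelyHypercyclic T ↔
      (∀ s, ReiterativelyHypercyclic (T s)) ∧ DisjointHypercyclic T :=
  ⟨fun h => ⟨h.reiterativelyHypercyclic, h.disjointHypercyclic⟩,
    fun ⟨hT, x, hx⟩ => ⟨x, hx.isFamilyHypercyclicVector_directSumOp hT⟩⟩

end Dynamics

theorem mainTheorem12 {𝕜 : Type*} [RCLike 𝕜] (p : ℝ≥0∞) [Fact (1 ≤ p)] (hp : p ≠ ∞) :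
    (∀ (f : Fin 2 → ℕ+ → ℕ+) (hf : ∀ s, StrictMono (f s)) (_hf1 : ∀ s, 1 < f s 1)
        (w : Fin 2 → ℕ+ → 𝕜) (hw : ∀ s, ∃ C : ℝ, ∀ j, ‖w s (f s j)‖ ≤ C),
        AlmostPartitionRegular familyUBd f → f 0 = f 1 →
        (DisjointReiterativelyHypercyclic (fun s => pseudoShift p (f s) (hf s) (w s) (hw s)) ↔
          (∀ s, ReiterativelyHypercyclic (pseudoShift p (f s) (hf s) (w s) (hw s))) ∧
            DisjointHypercyclic (fun s => pseudoShift p (f s) (hf s) (w s) (hw s)))) ∧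
    (∀ (w : Fin 2 → ℕ+ → 𝕜) (hw : ∀ s, ∃ C : ℝ, ∀ n, ‖w s n‖ ≤ C),
        DisjointReiterativelyHypercyclic (fun s => weightedShift p (w s) (hw s)) ↔
          (∀ s, ReiterativelyHypercyclic (weightedShift p (w s) (hw s))) ∧
            DisjointHypercyclic (fun s => weightedShift p (w s) (hw s))) := by
  exact ⟨fun f hf _ w hw _ _ => disjointReiterativelyHypercyclic_iff _,
    fun w hw => disjointReiterativelyHypercyclic_iff _⟩
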